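/- **Invariance of the generalized helicity.** *Setting.* Let $\Omega$ be a bounded open subset of $\mathbb R^3$ (for instance a bounded Lipschitz domain), or more generally a bounded open set with periodic boundary conditions in some coordinate directions (for instance a box with one pair of periodic faces). Let $(\cdot,\cdot)$ be the $L^2(\Omega)$ inner product, and let $H^1_0$, $H_0(\mathrm{curl})$, $H_0(\mathrm{div})$ be the closures of the smooth compactly supported functions or fields on $\Omega$ in the graph norms of $\mathrm{grad}$, $\mathrm{curl}$, $\mathrm{div}$ (on Lipschitz domains: the spaces with vanishing trace, tangential trace, and normal trace, respectively); let $L^2_0$ be the space of $L^2$ functions of mean zero. Assume that the complex $H^1_0\to H_0(\mathrm{curl})\to H_0(\mathrm{div})$ is exact at $H_0(\mathrm{curl})$: every $A\in H_0(\mathrm{curl})$ with $\mathrm{curl}\,A=0$ is $\mathrm{grad}\,\varphi$ for some $\varphi\in H^1_0$. Exactness at $H_0(\mathrm{div})$ is not assumed. Let $\tau>0$ and let $I\subset[0,\infty)$ be an interval containing $0$. A *Hodge decomposition* of $B\in L^2(\Omega)^3$ is $B=\mathrm{curl}\,A+B_H$ with $A\in H_0(\mathrm{curl})$ and $B_H\in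 H_0(\mathrm{div})$ harmonic, i.e. $\mathrm{div}\,B_H=0$ and $\mathrm{curl}\,B_H=0$. The *generalized helicity* is $\tilde{\mathcal H}(B)=(A,B+B_H)$. *(1) Continuous evolution.* Let $B\in C^1(I;L^2)$, $E\in C^0(I;L^2)$, $j(t)\in L^2$ and fields $u(t)$ satisfy, at every $t\in I$, $$\partial_tB+\mathrm{curl}\,E=0,\quad E+u\times B=0,\quad j=\mathrm{curl}\,B,\quad u=\tau\, j\times B,$$ with $B(t)\in H_0(\mathrm{div})$, $j(t),E(t)\in H_0(\mathrm{curl})$ and $\mathrm{div}\,B(0)=0$. Suppose that $B(s)$ has a Hodge decomposition at some time $s\in I$ (on bounded Lipschitz domains it always has one), and let $h$ be the resulting value $(A,B(s)+B_H)$. Then at every $t\in I$ the field $B(t)$ has a Hodge decomposition, and each of its Hodge decompositions, in any gauge, gives $\tilde{\mathcal H}(B(t))=h$. *(2) Semi-discrete scheme.* Let $V_0\to V_1\to V_2\to V_3$ (by $\mathrm{grad},\mathrm{curl},\mathrm{div}$) be a finite-dimensional subcomplex of $H^1_0\to H_0(\mathrm{curl})\to H_0(\mathrm{div})\to L^2_0$.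 Let $B_h\in C^1(I;V_2)$ with $\mathrm{div}\,B_h(0)=0$, and $E_h,j_h,H_h\in C^0(I;V_1)$, satisfy at every $t \in I$ $$(\partial_tB_h,C)+(\mathrm{curl}\,E_h,C)=0,\qquad (E_h,F)+\tau\,((j_h\times H_h)\times H_h,F)=0,$$ $$(j_h,K)=(B_h,\mathrm{curl}\,K),\qquad (H_h,G)=(B_h,G)$$ for all $C\in V_2$ and $F,K,G\in V_1$ (the triple products being integrable). A *discrete Hodge decomposition* is $B_h=\mathrm{curl}\,A_h+B_{Hh}$ with $A_h\in V_1$, $B_{Hh}\in V_2$, $\mathrm{div}\,B_{Hh}=0$ and $B_{Hh}\perp\mathrm{curl}\,V_1$. Then $B_h(t)$ has a discrete Hodge decomposition at every $t\in I$, and $\tilde{\mathcal H}_h=(A_h,B_h+B_{Hh})$ depends neither on the chosen decomposition nor on $t\in I$. *(3) Fully discrete scheme.* Let $B^0\in V_2$ with $\mathrm{div}\,B^0=0$, and let $B^1,\dots,B^N$ be obtained from $B^0$ by $N$ steps, of arbitrary positive sizes, of the $s$-stage Gauss collocation method applied to the scheme in (2). Then every $B^n$, $0\le n\le N$, has a discrete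 Hodge decomposition, and $\tilde{\mathcal H}_h(B^n)$ depends neither on the chosen decomposition nor on $n$. -/

import Mathlib

open MeasureTheory Set
open scoped ContDiff

noncomputable section

namespace MagnetoFriction

/-- Euclidean three-space. -/
abbrev E3 : Type := EuclideanSpace ℝ (Fin 3)

/-- The cross product on Euclidean three-space. -/
def cross (a b : E3) : E3 := WithLp.toLp 2 (crossProduct (WithLp.ofLp a) (WithLp.ofLp b))

/-- The partial derivative in the `i`-th coordinate direction. -/
def pd (φ : E3 → E3) (i : Fin 3) (x : E3) : E3 := fderiv ℝ φ x (EuclideanSpace.single i 1)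

/-- The classical curl of a differentiable vector field. -/
def classicalCurl (φ : E3 → E3) (x : E3) : E3 :=
  !₂[(pd φ 1 x) 2 - (pd φ 2 x) 1, (pd φ 2 x) 0 - (pd φ 0 x) 2, (pd φ 0 x) 1 - (pd φ 1 x) 0]

/-- The classical divergence of a differentiable vector field. -/
def classicalDiv (φ : E3 → E3) (x : E3) : ℝ := ∑ i, (pd φ i x) i

/-- A bounded open set `Ω`, possibly with periodic boundary conditions in some coordinate
directions. `period i = 0` means that direction `i` is not periodic; otherwise `period i` is the
period in that direction, and `carrier` is the periodic unfolding of the domain in `ℝ³`.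
With `period = 0` this is exactly a bounded open subset `carrier` of `ℝ³`. -/
structure Domain where
  carrier : Set E3
  period : Fin 3 → ℝ
  period_nonneg : ∀ i, 0 ≤ period i
  isOpen : IsOpen carrier
  periodic : ∀ i x, x + EuclideanSpace.single i (period i) ∈ carrier ↔ x ∈ carrier
  bounded : Bornology.IsBounded
    (carrier ∩ {x | ∀ i, period i ≠ 0 → x i ∈ Ico 0 (period i)})

namespace Domain

variable (D : Domain)

/-- One periodicity cell (all of `ℝ³` if no direction is periodic). -/
def cell : Set E3 := {x | ∀ i, D.period i ≠ 0 → x i ∈ Ico 0 (D.period i)}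

/-- Lebesgue measure on the domain (on one periodicity cell of it). -/
def vol : Measure E3 := volume.restrict (D.carrier ∩ D.cell)

/-- The space `L²(Ω)` of scalar functions. -/
abbrev L2S : Type := Lp ℝ 2 D.vol

/-- The space `L²(Ω)` of vector fields. -/
abbrev L2V : Type := Lp E3 2 D.vol

/-- Test functions: smooth, periodic in the periodic directions, with support contained in the
domain and compact modulo the periods. Without periods this is `C_c^∞(Ω)`. -/
structure IsTest {F : Type} [NormedAddCommGroup F] [NormedSpace ℝ F] (φ : E3 → F) : Prop where
  smooth : ContDiff ℝ ∞ φ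
  periodic : ∀ i x, φ (x + EuclideanSpace.single i (D.period i)) = φ x
  support_subset : tsupport φ ⊆ D.carrier
  compact : IsCompact (closure D.cell ∩ tsupport φ)

/-- The gradient on test functions, as a set of pairs `(f, grad f)` in `L² × L²`. -/
def testGrad : Set (D.L2S × D.L2V) :=
  {p | ∃ f : E3 → ℝ, D.IsTest f ∧ p.1 =ᵐ[D.vol] f ∧ p.2 =ᵐ[D.vol] gradient f}

/-- The curl on test fields, as a set of pairs `(φ, curl φ)` in `L² × L²`. -/
def testCurl : Set (D.L2V × D.L2V) :=
  {p | ∃ φ : E3 → E3, D.IsTest φ ∧ p.1 =ᵐ[D.vol] φ ∧ p.2 =ᵐ[D.vol] classicalCurl φ}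

/-- The divergence on test fields, as a set of pairs `(φ, div φ)` in `L² × L²`. -/
def testDiv : Set (D.L2V × D.L2S) :=
  {p | ∃ φ : E3 → E3, D.IsTest φ ∧ p.1 =ᵐ[D.vol] φ ∧ p.2 =ᵐ[D.vol] classicalDiv φ}

/-- `f ∈ H¹₀` and `g = grad f`; here `H¹₀` is the closure of the test functions in the graph norm
of `grad`. -/
def IsGrad₀ (f : D.L2S) (g : D.L2V) : Prop := (f, g) ∈ closure D.testGrad

/-- `v ∈ H₀(curl)` and `w = curl v`; here `H₀(curl)` (tangential trace zero) is the closure of the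
test fields in the graph norm of `curl`. -/
def IsCurl₀ (v w : D.L2V) : Prop := (v, w) ∈ closure D.testCurl

/-- `v ∈ H₀(div)` and `q = div v`; here `H₀(div)` (normal trace zero) is the closure of the
test fields in the graph norm of `div`. -/
def IsDiv₀ (v : D.L2V) (q : D.L2S) : Prop := (v, q) ∈ closure D.testDiv

/-- `v ∈ H(curl)` and `w = curl v`, in the sense of distributions (no boundary condition):
`(v, curl φ) = (w, φ)` for all test fields `φ`. -/
def IsWeakCurl (v w : D.L2V) : Prop := ∀ p ∈ D.testCurl, inner ℝ v p.2 = inner ℝ w p.1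

/-- Exactness of `H¹₀ → H₀(curl) → H₀(div)` at `H₀(curl)`: every curl-free field in `H₀(curl)` is
the gradient of a function in `H¹₀`. -/
def ExactAtCurl : Prop := ∀ A : D.L2V, D.IsCurl₀ A 0 → ∃ f : D.L2S, D.IsGrad₀ f A

/-- Harmonic 2-forms: fields in `H₀(div)` that are divergence-free and curl-free. -/
def IsHarmonic (v : D.L2V) : Prop := D.IsDiv₀ v 0 ∧ D.IsWeakCurl v 0

/-- `B = curl A + B_H` with `A ∈ H₀(curl)` and `B_H` harmonic. -/
def IsHodge (B A BH : D.L2V) : Prop :=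
  D.IsHarmonic BH ∧ ∃ cA, D.IsCurl₀ A cA ∧ B = cA + BH

/-- `h` is a value `(A, B + B_H)` of the generalized helicity of `B`, for some Hodge decomposition
`B = curl A + B_H` (in an arbitrary gauge). -/
def HasHelicity (B : D.L2V) (h : ℝ) : Prop :=
  ∃ A BH : D.L2V, D.IsHodge B A BH ∧ h = inner ℝ A (B + BH)

/-- Solutions on the time interval `I` of the magneto-frictional equations
`∂ₜB + curl E = 0`, `E + u × B = 0`, `j = curl B`, `u = τ j × B`,
with `B · n = 0`, `j × n = 0`, `E × n = 0` on the boundary and `div B = 0` at time `0`;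
`B` is `C¹` and `E` is continuous in time with values in `L²`. -/
structure IsSolution (τ : ℝ) (I : Set ℝ) (B E j : ℝ → D.L2V) (u : ℝ → E3 → E3) : Prop where
  advection : ∃ dB : ℝ → D.L2V, ContinuousOn dB I ∧
    ∀ t ∈ I, HasDerivWithinAt B (dB t) I t ∧ ∃ cE, D.IsCurl₀ (E t) cE ∧ dB t + cE = 0
  continuous_E : ContinuousOn E I
  ohm : ∀ t ∈ I, ∀ᵐ x ∂D.vol, E t x + cross (u t x) (B t x) = 0
  ampere : ∀ t ∈ I, D.IsWeakCurl (B t) (j t)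
  velocity : ∀ t ∈ I, ∀ᵐ x ∂D.vol, u t x = τ • cross (j t x) (B t x)
  boundary_B : ∀ t ∈ I, ∃ q, D.IsDiv₀ (B t) q
  boundary_j : ∀ t ∈ I, ∃ w, D.IsCurl₀ (j t) w
  gauss_zero : D.IsDiv₀ (B 0) 0

/-- A finite-dimensional subcomplex `V₀ → V₁ → V₂ → V₃` (by `grad`, `curl`, `div`) of
`H¹₀ → H₀(curl) → H₀(div) → L²₀`. -/
structure Subcomplex where
  V₀ : Submodule ℝ D.L2S
  V₁ : Submodule ℝ D.L2V
  V₂ : Submodule ℝ D.L2V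
  V₃ : Submodule ℝ D.L2S
  finite₀ : FiniteDimensional ℝ V₀
  finite₁ : FiniteDimensional ℝ V₁
  finite₂ : FiniteDimensional ℝ V₂
  finite₃ : FiniteDimensional ℝ V₃
  grad_mem : ∀ f ∈ V₀, ∃ g ∈ V₁, D.IsGrad₀ f g
  curl_mem : ∀ v ∈ V₁, ∃ w ∈ V₂, D.IsCurl₀ v w
  div_mem : ∀ v ∈ V₂, ∃ q ∈ V₃, D.IsDiv₀ v q
  mean_zero : ∀ q ∈ V₃, ∫ x, q x ∂D.vol = 0

namespace Subcomplex

variable {D} (S : D.Subcomplex)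

/-- `v ∈ V₁` and `w = curl v ∈ V₂`. -/
def IsCurl (v w : D.L2V) : Prop := v ∈ S.V₁ ∧ w ∈ S.V₂ ∧ D.IsCurl₀ v w

/-- Discrete harmonic 2-forms: divergence-free fields in `V₂` whose discrete curl (the `L²` adjoint
of `curl : V₁ → V₂`) vanishes. -/
def IsHarmonic (v : D.L2V) : Prop :=
  v ∈ S.V₂ ∧ D.IsDiv₀ v 0 ∧ ∀ K cK, S.IsCurl K cK → inner ℝ v cK = 0

/-- The discrete Hodge decomposition `B = curl A + B_H` with `A ∈ V₁` and `B_H` discretely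
harmonic. -/
def IsHodge (B A BH : D.L2V) : Prop :=
  S.IsHarmonic BH ∧ ∃ cA, S.IsCurl A cA ∧ B = cA + BH

/-- `h` is a value `(A, B + B_H)` of the discrete generalized helicity of `B`, for some discrete
Hodge decomposition `B = curl A + B_H`. -/
def HasHelicity (B : D.L2V) (h : ℝ) : Prop :=
  ∃ A BH : D.L2V, S.IsHodge B A BH ∧ h = inner ℝ A (B + BH)

/-- The equations of the structure-preserving scheme at one instant, for the field `B`, its time
derivative `dB` and the auxiliary fields `E`, `j`, `H`. -/
structure SchemeAt (τ : ℝ) (B dB E j H : D.L2V) : Prop where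
  mem_B : B ∈ S.V₂
  mem_j : j ∈ S.V₁
  mem_H : H ∈ S.V₁
  advection : ∃ cE, S.IsCurl E cE ∧ ∀ C ∈ S.V₂, inner ℝ dB C + inner ℝ cE C = 0
  ohm : ∀ F ∈ S.V₁,
    Integrable (fun x => inner ℝ (cross (cross (j x) (H x)) (H x)) (F x)) D.vol ∧
    inner ℝ E F + τ * ∫ x, inner ℝ (cross (cross (j x) (H x)) (H x)) (F x) ∂D.vol = 0
  current : ∀ K cK, S.IsCurl K cK → inner ℝ j K = inner ℝ B cK
  field : ∀ G ∈ S.V₁, inner ℝ H G = inner ℝ B G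

/-- Solutions of the semi-discrete scheme on the time interval `I`, with `B` of class `C¹` and
`E`, `j`, `H` continuous in time, and divergence-free initial field. -/
structure IsSolution (τ : ℝ) (I : Set ℝ) (B E j H : ℝ → D.L2V) : Prop where
  scheme : ∃ dB : ℝ → D.L2V, ContinuousOn dB I ∧
    ∀ t ∈ I, HasDerivWithinAt B (dB t) I t ∧ S.SchemeAt τ (B t) (dB t) (E t) (j t) (H t)
  continuous_E : ContinuousOn E I
  continuous_j : ContinuousOn j I
  continuous_H : ContinuousOn H I
  gauss_zero : D.IsDiv₀ (B 0) 0

/-- One step, of size `δ` and from `Bold` to `Bnew`, of the collocation method with nodes `c`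
applied to the semi-discrete scheme: there is a polynomial of degree at most `s` in time with
values in `V₂` that starts at `Bold`, satisfies the scheme at the times `c i * δ` (with stage values
`E i`, `j i`, `H i`), and ends at `Bnew`. -/
def IsCollocationStep (τ : ℝ) {s : ℕ} (c : Fin s → ℝ) (δ : ℝ) (Bold Bnew : D.L2V) : Prop :=
  ∃ (a : Fin (s + 1) → D.L2V) (p : ℝ → D.L2V) (E j H : Fin s → D.L2V),
    (∀ k, a k ∈ S.V₂) ∧ (∀ r, p r = ∑ k : Fin (s + 1), r ^ (k : ℕ) • a k) ∧ p 0 = Bold ∧ p δ = Bnew ∧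
    ∀ i, S.SchemeAt τ (p (c i * δ)) (deriv p (c i * δ)) (E i) (j i) (H i)

end Subcomplex

end Domain

/-- The nodes of the `s`-stage Gauss method: the `s` distinct zeros of the shifted Legendre
polynomial `dˢ/dxˢ (xˢ (x - 1)ˢ)`. -/
def IsGaussNodes {s : ℕ} (c : Fin s → ℝ) : Prop :=
  Function.Injective c ∧ ∀ i, (Polynomial.derivative^[s]
    ((Polynomial.X : Polynomial ℝ) ^ s * (Polynomial.X - 1) ^ s)).IsRoot (c i)

end MagnetoFriction

end

/-! The tangential boundary condition makes `curl` on `H₀(curl)` symmetric, and harmonic fields are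
orthogonal to its range. By exactness its kernel consists of gradients of `H¹₀` functions, which are
orthogonal to divergence-free fields in `H₀(div)`, hence to harmonic ones. `HodgePair` records these
facts together with closedness of the graph; the rest of the argument happens in a Hilbert space and
serves the continuous and discrete complexes alike.

Gauge invariance (`hasHelicity_unique`): two decompositions differ by a vector that is both a curl
and a difference of harmonic fields, hence zero. So `B_H` is unique, `d = A - A'` is curl-free, and
`(d, curl A + 2 B_H) = (curl d, A) + 0 = 0`.

Conservation (`hasHelicity_of_curve`): the potential `A - ∫ E` keeps `B_H` fixed, and symmetry gives
the helicity the derivative `-2 (E, B)`. This vanishes because `E` is pointwise orthogonal to `B`.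
In the scheme, testing Ohm's law with `H` gives `(E, H) = 0`, and `H` is the projection of `B` onto
`V₁ ∋ E`.

Gauss steps (`hasHelicity_of_gauss`): with the stage fields interpolated in time, the derivative of
the helicity is a polynomial of degree at most `2 s - 1` that vanishes at the nodes, so its integral
over the step is zero. -/

noncomputable section

namespace MagnetoFriction

/-! ### Hilbert-space setting and primitives of curves. -/

/-- The abstract setting of the generalized helicity in a Hilbert space: the graph `curl` of a
closed symmetric operator, and a set of harmonic vectors orthogonal to its range and kernel. -/
structure HodgePair (X : Type*) [NormedAddCommGroup X] [InnerProductSpace ℝ X] where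
  curl : Submodule ℝ (X × X)
  isClosed_curl : IsClosed (curl : Set (X × X))
  harmonic : Set X
  curl_symm : ∀ p ∈ curl, ∀ q ∈ curl, inner ℝ p.1 q.2 = inner ℝ p.2 q.1
  harmonic_range : ∀ v ∈ harmonic, ∀ p ∈ curl, inner ℝ v p.2 = 0
  harmonic_ker : ∀ v ∈ harmonic, ∀ p ∈ curl, p.2 = 0 → inner ℝ p.1 v = 0

/-- A primitive of a continuous curve in a closed subspace stays in that subspace. -/
theorem exists_primitive_mem {Y : Type*} [NormedAddCommGroup Y] [NormedSpace ℝ Y]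
    [CompleteSpace Y] (M : Submodule ℝ Y) (hM : IsClosed (M : Set Y)) {s t : ℝ} {g : ℝ → Y}
    (hg : ContinuousOn g (uIcc s t)) (hgM : ∀ r ∈ uIcc s t, g r ∈ M) :
    ∃ P : ℝ → Y, P s = 0 ∧ (∀ r, P r ∈ M) ∧
      ∀ r ∈ uIcc s t, HasDerivWithinAt P (g r) (uIcc s t) r := by
  -- Integrating inside the complete space `M` makes membership automatic; applied to a closed
  -- graph, this interchanges `curl` with the time integral.
  have : CompleteSpace M := hM.completeSpace_coe
  have hle : min s t ≤ max s t := min_le_max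
  let g₀ : Icc (min s t) (max s t) → M := fun r => ⟨g r, hgM r r.2⟩
  have hg₀ : Continuous g₀ :=
    Continuous.subtype_mk (continuousOn_iff_continuous_domRestrict.1 hg) _
  -- The constant extension beyond the endpoints is continuous on all of `ℝ`, so the two-sided
  -- fundamental theorem applies at the endpoints too.
  let G : ℝ → M := IccExtend hle g₀
  have hG : Continuous G := hg₀.Icc_extend'
  refine ⟨fun r => ((∫ x in s..r, G x : M) : Y), by simp, fun r => Subtype.coe_prop _, ?_⟩
  intro r hr
  have h1 : HasDerivAt (fun r => ∫ x in s..r, G x) (G r) r :=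
    hG.integral_hasStrictDerivAt s r |>.hasDerivAt
  have h2 := (M.subtypeL.hasFDerivAt.comp_hasDerivAt r h1).hasDerivWithinAt (s := uIcc s t)
  have h3 : M.subtypeL (G r) = g r := by
    simp only [G]
    rw [IccExtend_of_mem hle g₀ hr]
    rfl
  rw [h3] at h2
  exact h2

theorem eq_of_hasDerivWithinAt_zero {Y : Type*} [NormedAddCommGroup Y] [NormedSpace ℝ Y]
    {s t : ℝ} {f : ℝ → Y} (hf : ∀ r ∈ uIcc s t, HasDerivWithinAt f 0 (uIcc s t) r) :
    f t = f s := by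
  have := (convex_uIcc s t).norm_image_sub_le_of_norm_hasDerivWithin_le (C := 0) hf
    (fun _ _ => by simp) left_mem_uIcc right_mem_uIcc
  rw [zero_mul] at this
  exact sub_eq_zero.1 (norm_le_zero_iff.1 this)

/-! ### Gauss quadrature. -/

/-- Integration by parts `s` times against a polynomial of degree less than `s`. -/
theorem exists_primitive_iterate_derivative_mul (s : ℕ) : ∀ k ≤ s, ∀ r : Polynomial ℝ,
    r.degree < k → ∃ Q : Polynomial ℝ,
      Polynomial.derivative Q = Polynomial.derivative^[k]
        ((Polynomial.X : Polynomial ℝ) ^ s * (Polynomial.X - 1) ^ s) * r ∧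
      Q.eval 0 = 0 ∧ Q.eval 1 = 0 := by
  intro k
  induction k with
  | zero =>
    intro _ r hr
    have : r = 0 := by
      ext m
      simpa using (Polynomial.degree_lt_iff_coeff_zero r 0).1 hr m m.zero_le
    exact ⟨0, by simp [this]⟩
  | succ k ih =>
    intro hk r hr
    obtain ⟨Q, hQ, h0, h1⟩ := ih (by omega) (Polynomial.derivative r) (by
      rcases eq_or_ne r 0 with rfl | hr0
      · simp
      · have := Polynomial.degree_derivative_lt hr0
        refine lt_of_lt_of_le this ?_
        rw [Polynomial.degree_eq_natDegree hr0] at hr ⊢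
        exact_mod_cast Nat.lt_succ_iff.1 (by exact_mod_cast hr))
    set w : Polynomial ℝ := Polynomial.X ^ s * (Polynomial.X - 1) ^ s with hw
    have hX : (Polynomial.X : Polynomial ℝ) ∣ Polynomial.derivative^[k] w :=
      (dvd_pow_self _ (by omega : s - k ≠ 0)).trans
        (Polynomial.pow_sub_dvd_iterate_derivative_of_pow_dvd k (Dvd.intro _ rfl))
    have hX1 : (Polynomial.X - 1 : Polynomial ℝ) ∣ Polynomial.derivative^[k] w :=
      (dvd_pow_self _ (by omega : s - k ≠ 0)).trans
        (Polynomial.pow_sub_dvd_iterate_derivative_of_pow_dvd k (Dvd.intro_left _ rfl))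
    -- One integration by parts: `Q` is a primitive of `w⁽ᵏ⁾ r'`, and the boundary terms vanish
    -- because `k < s` leaves a factor `X (X - 1)` in `w⁽ᵏ⁾`.
    refine ⟨Polynomial.derivative^[k] w * r - Q, ?_, ?_, ?_⟩
    · rw [Polynomial.derivative_sub, Polynomial.derivative_mul, hQ,
        Function.iterate_succ_apply']
      ring
    · obtain ⟨v, hv⟩ := hX
      simp [hv, h0]
    · obtain ⟨v, hv⟩ := hX1
      simp [hv, h1]

theorem degree_iterate_derivative_rodrigues (s : ℕ) :
    (Polynomial.derivative^[s]
      ((Polynomial.X : Polynomial ℝ) ^ s * (Polynomial.X - 1) ^ s)).degree = s := by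
  rw [← Polynomial.C_1]
  have hmonic : ((Polynomial.X : Polynomial ℝ) ^ s * (Polynomial.X - Polynomial.C 1) ^ s).Monic :=
    (Polynomial.monic_X_pow s).mul ((Polynomial.monic_X_sub_C (1 : ℝ)).pow s)
  have hdeg : ((Polynomial.X : Polynomial ℝ) ^ s * (Polynomial.X - Polynomial.C 1) ^ s).natDegree =
      s + s := by
    rw [(Polynomial.monic_X_pow s).natDegree_mul ((Polynomial.monic_X_sub_C (1 : ℝ)).pow s),
      Polynomial.natDegree_X_pow, (Polynomial.monic_X_sub_C (1 : ℝ)).natDegree_pow,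
      Polynomial.natDegree_X_sub_C, mul_one]
  apply le_antisymm
  · refine Polynomial.degree_le_of_natDegree_le ?_
    refine (Polynomial.natDegree_iterate_derivative _ s).trans ?_
    omega
  · apply Polynomial.le_degree_of_ne_zero
    rw [Polynomial.coeff_iterate_derivative]
    have : ((Polynomial.X : Polynomial ℝ) ^ s * (Polynomial.X - Polynomial.C 1) ^ s).coeff
        (s + s) = 1 := by
      rw [← hdeg]; exact hmonic
    rw [this, nsmul_eq_mul, mul_one]
    exact_mod_cast (Nat.descFactorial_pos.2 (by omega)).ne'

/-- Exactness of Gauss quadrature on polynomials that vanish at the nodes. -/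
theorem IsGaussNodes.eq_of_hasDerivAt {s : ℕ} {c : Fin s → ℝ} (hc : IsGaussNodes c)
    {q : Polynomial ℝ} (hdeg : q.degree < ((2 * s : ℕ) : WithBot ℕ)) (hq : ∀ i, q.eval (c i) = 0)
    {h : ℝ → ℝ} (hh : ∀ x, HasDerivAt h (q.eval x) x) : h 1 = h 0 := by
  set L := Polynomial.derivative^[s]
    ((Polynomial.X : Polynomial ℝ) ^ s * (Polynomial.X - 1) ^ s) with hL
  have hLdeg : L.degree = s := degree_iterate_derivative_rodrigues s
  have hL0 : L ≠ 0 := by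
    rintro h0
    simp [h0] at hLdeg
  obtain ⟨r, hr⟩ : ∃ r, q = L * r := by
    -- The remainder has degree less than `s` and vanishes at the `s` distinct nodes.
    have hmod : q % L = 0 := by
      apply Polynomial.eq_zero_of_degree_lt_of_eval_index_eq_zero (v := c) (s := Finset.univ)
        hc.1.injOn
      · rw [Finset.card_univ, Fintype.card_fin, ← hLdeg]
        exact Polynomial.degree_mod_lt q hL0
      · intro i _
        have h1 := congrArg (Polynomial.eval (c i)) (EuclideanDomain.div_add_mod q L)
        rw [Polynomial.eval_add, Polynomial.eval_mul, hq i, (hc.2 i : L.eval (c i) = 0)] at h1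
        simpa using h1
    exact (EuclideanDomain.mod_eq_zero.1 hmod)
  have hrdeg : r.degree < s := by
    rcases eq_or_ne r 0 with rfl | hr0
    · simp
    rw [hr, Polynomial.degree_mul, hLdeg, Polynomial.degree_eq_natDegree hr0] at hdeg
    rw [Polynomial.degree_eq_natDegree hr0]
    have : s + r.natDegree < 2 * s := by exact_mod_cast hdeg
    exact_mod_cast (by omega : r.natDegree < s)
  obtain ⟨Q, hQ, h0, h1⟩ := exists_primitive_iterate_derivative_mul s s le_rfl r hrdeg
  have hd : ∀ x ∈ uIcc (0 : ℝ) 1,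
      HasDerivWithinAt (fun x => h x - Q.eval x) 0 (uIcc (0 : ℝ) 1) x := by
    intro x _
    have := ((hh x).sub (Q.hasDerivAt x))
    rw [hQ, hr, sub_self] at this
    exact this.hasDerivWithinAt
  have := eq_of_hasDerivWithinAt_zero hd
  simpa [h0, h1] using this

/-! ### Gauge invariance and conservation of helicity in Hilbert space. -/

namespace HodgePair

variable {X : Type*} [NormedAddCommGroup X] [InnerProductSpace ℝ X] (P : HodgePair X)

/-- `h` is a value `(A, B + B_H)` of the generalized helicity of `B`. -/
def HasHelicity (B : X) (h : ℝ) : Prop :=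
  ∃ A BH : X, (BH ∈ P.harmonic ∧ ∃ cA, (A, cA) ∈ P.curl ∧ B = cA + BH) ∧
    h = inner ℝ A (B + BH)

theorem hasHelicity_unique {B : X} {h h' : ℝ} (H : P.HasHelicity B h) (H' : P.HasHelicity B h') :
    h = h' := by
  obtain ⟨A, BH, ⟨hBH, cA, hA, hB⟩, rfl⟩ := H
  obtain ⟨A', BH', ⟨hBH', cA', hA', hB'⟩, rfl⟩ := H'
  have hd : (A - A', cA - cA') ∈ P.curl := P.curl.sub_mem hA hA'
  have he : cA - cA' = BH' - BH := by
    rw [sub_eq_sub_iff_add_eq_add, ← hB, add_comm, ← hB']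
  -- A curl that is a difference of harmonic vectors is orthogonal to itself.
  have hz : cA - cA' = 0 := by
    rw [← inner_self_eq_zero (𝕜 := ℝ)]
    nth_rw 1 [he]
    rw [inner_sub_left, P.harmonic_range _ hBH' _ hd, P.harmonic_range _ hBH _ hd, sub_zero]
  have hH : BH' = BH := by rwa [hz, eq_comm, sub_eq_zero] at he
  subst hH
  rw [← sub_eq_zero, ← inner_sub_left, hB, add_assoc, inner_add_right, inner_add_right,
    P.harmonic_ker _ hBH _ hd hz, P.curl_symm _ hd _ hA]
  simp [hz]

/-- The helicity is conserved along curves with `∂ₜB + curl E = 0` and `(E, B) = 0`. -/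
theorem hasHelicity_of_curve [CompleteSpace X] {s t : ℝ} {B E cE : ℝ → X}
    (hE : ContinuousOn E (uIcc s t)) (hcE : ContinuousOn cE (uIcc s t))
    (hcurl : ∀ r ∈ uIcc s t, (E r, cE r) ∈ P.curl)
    (hB : ∀ r ∈ uIcc s t, HasDerivWithinAt B (-cE r) (uIcc s t) r)
    (horth : ∀ r ∈ uIcc s t, inner ℝ (E r) (B r) = 0) {h : ℝ} (H : P.HasHelicity (B s) h) :
    P.HasHelicity (B t) h := by
  obtain ⟨A, BH, ⟨hBH, cA, hA, hBs⟩, rfl⟩ := H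
  obtain ⟨F, hF0, hFM, hF⟩ := exists_primitive_mem P.curl P.isClosed_curl
    (g := fun r => (E r, cE r)) (hE.prodMk hcE) hcurl
  have hF1 : ∀ r ∈ uIcc s t, HasDerivWithinAt (fun r => (F r).1) (E r) (uIcc s t) r :=
    fun r hr => (ContinuousLinearMap.fst ℝ X X).hasFDerivAt.comp_hasDerivWithinAt r (hF r hr)
  have hF2 : ∀ r ∈ uIcc s t, HasDerivWithinAt (fun r => (F r).2) (cE r) (uIcc s t) r :=
    fun r hr => (ContinuousLinearMap.snd ℝ X X).hasFDerivAt.comp_hasDerivWithinAt r (hF r hr)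
  have hAF : ∀ r, (A - (F r).1, cA - (F r).2) ∈ P.curl := fun r => P.curl.sub_mem hA (hFM r)
  -- The sum of `B` and the primitive of `curl E` is constant, so the harmonic part never changes.
  have hdec : ∀ r ∈ uIcc s t, B r = (cA - (F r).2) + BH := by
    intro r hr
    have hsub : uIcc s r ⊆ uIcc s t := uIcc_subset_uIcc_left hr
    have := eq_of_hasDerivWithinAt_zero (s := s) (t := r) (f := fun r => B r + (F r).2)
      fun x hx => by
        have := ((hB x (hsub hx)).add (hF2 x (hsub hx))).mono hsub
        rwa [neg_add_cancel] at this
    simp only [hF0, Prod.snd_zero, add_zero, hBs] at this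
    rw [eq_sub_of_add_eq this]
    abel
  refine ⟨A - (F t).1, BH, ⟨hBH, _, hAF t, hdec t right_mem_uIcc⟩, ?_⟩
  have := eq_of_hasDerivWithinAt_zero (s := s) (t := t)
    (f := fun r => (inner ℝ (A - (F r).1) (B r + BH) : ℝ)) fun r hr => by
      have := ((hF1 r hr).const_sub A).inner ℝ ((hB r hr).add_const BH)
      refine this.congr_deriv ?_
      -- Symmetry turns `(A, curl E)` into `(B - B_H, E)`: the harmonic terms cancel and `-2 (E, B)`
      -- remains.
      have h1 := P.curl_symm _ (hAF r) _ (hcurl r hr)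
      have h2 : cA - (F r).2 = B r - BH := by rw [hdec r hr]; abel
      simp only [h2] at h1
      rw [inner_neg_right, h1, inner_neg_left, inner_add_right, horth r hr, inner_sub_left,
        real_inner_comm (E r) (B r), horth r hr, real_inner_comm (E r) BH]
      ring
  simp only [hF0, Prod.fst_zero, sub_zero] at this
  exact this.symm

/-- The helicity is conserved by Gauss collocation steps. -/
theorem hasHelicity_of_gauss {s : ℕ} {c : Fin s → ℝ} (hc : IsGaussNodes c)
    (b : Fin (s + 1) → X) (p : ℝ → X) (hp : ∀ x, p x = ∑ k : Fin (s + 1), x ^ (k : ℕ) • b k)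
    (e ce : Fin s → X) (hcurl : ∀ i, (e i, ce i) ∈ P.curl)
    (hder : ∀ i, HasDerivAt p (ce i) (c i)) (horth : ∀ i, inner ℝ (e i) (p (c i)) = 0)
    {h : ℝ} (H : P.HasHelicity (p 0) h) : P.HasHelicity (p 1) h := by
  obtain ⟨A, BH, ⟨hBH, cA, hA, hB0⟩, rfl⟩ := H
  let l : Fin s → Polynomial ℝ := fun i => Lagrange.basis Finset.univ c i
  let K : Fin s → ℝ → ℝ := fun i x => ∫ y in (0 : ℝ)..x, (l i).eval y
  have hK : ∀ i x, HasDerivAt (K i) ((l i).eval x) x := fun i x =>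
    ((l i).continuous.integral_hasStrictDerivAt 0 x).hasDerivAt
  have hK0 : ∀ i, K i 0 = 0 := fun i => by simp [K]
  have hinterp : ∀ m < s, ∀ x : ℝ, x ^ m = ∑ i, c i ^ m * (l i).eval x := by
    intro m hm x
    have h1 := Lagrange.eq_interpolate (f := (Polynomial.X : Polynomial ℝ) ^ m)
      (s := Finset.univ) (v := c) hc.1.injOn (by
        rw [Polynomial.degree_X_pow, Finset.card_univ, Fintype.card_fin]; exact_mod_cast hm)
    have h2 := congrArg (Polynomial.eval x) h1
    simpa [Lagrange.interpolate_apply, Polynomial.eval_finsetSum] using h2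
  have hp' : ∀ x,
      HasDerivAt p (∑ k : Fin (s + 1), (((k : ℕ) : ℝ) * x ^ ((k : ℕ) - 1)) • b k) x := by
    intro x
    have : p = fun x => ∑ k : Fin (s + 1), x ^ (k : ℕ) • b k := funext hp
    rw [this]
    exact HasDerivAt.fun_sum fun k _ => (hasDerivAt_pow (k : ℕ) x).smul_const (b k)
  -- `p'` has degree less than `s`, so it equals its Lagrange interpolant at the nodes.
  have hpe : ∀ x, HasDerivAt p (∑ i, (l i).eval x • ce i) x := by
    intro x
    convert hp' x using 1
    have h1 : ∀ i, ce i = ∑ k : Fin (s + 1), (((k : ℕ) : ℝ) * c i ^ ((k : ℕ) - 1)) • b k :=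
      fun i => (hder i).unique (hp' (c i))
    simp_rw [h1, Finset.smul_sum]
    rw [Finset.sum_comm]
    refine Finset.sum_congr rfl fun k _ => ?_
    -- At `k = 0` the exponent `k - 1` truncates to `0`, but the factor `k` kills the term.
    rcases Nat.eq_zero_or_pos (k : ℕ) with hk | hk
    · simp [hk]
    · rw [hinterp ((k : ℕ) - 1) (by omega) x, Finset.mul_sum, Finset.sum_smul]
      refine Finset.sum_congr rfl fun i _ => ?_
      rw [smul_smul]
      congr 1
      ring
  let F : ℝ → X := fun x => ∑ i, K i x • e i
  let cF : ℝ → X := fun x => ∑ i, K i x • ce i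
  have hF : ∀ x, HasDerivAt F (∑ i, (l i).eval x • e i) x := fun x =>
    HasDerivAt.fun_sum fun i _ => (hK i x).smul_const (e i)
  have hcF : ∀ x, HasDerivAt cF (∑ i, (l i).eval x • ce i) x := fun x =>
    HasDerivAt.fun_sum fun i _ => (hK i x).smul_const (ce i)
  have hmem : ∀ a : Fin s → ℝ, (∑ i, a i • e i, ∑ i, a i • ce i) ∈ P.curl := by
    intro a
    have : (∑ i, a i • e i, ∑ i, a i • ce i) = ∑ i, a i • (e i, ce i) := by
      ext <;> simp [Prod.fst_sum, Prod.snd_sum]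
    rw [this]
    exact P.curl.sum_mem fun i _ => P.curl.smul_mem _ (hcurl i)
  have hAF : ∀ x, (A + F x, cA + cF x) ∈ P.curl := fun x => P.curl.add_mem hA (hmem _)
  have hdec : ∀ x, p x = (cA + cF x) + BH := by
    intro x
    have := eq_of_hasDerivWithinAt_zero (s := 0) (t := x) (f := fun x => p x - cF x)
      fun y _ => by
        have := ((hpe y).sub (hcF y)).hasDerivWithinAt (s := uIcc 0 x)
        rwa [sub_self] at this
    have h0 : cF 0 = 0 := by simp [cF, hK0]
    simp only [h0, sub_zero, hB0] at this
    rw [sub_eq_iff_eq_add.1 this]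
    abel
  refine ⟨A + F 1, BH, ⟨hBH, _, hAF 1, hdec 1⟩, ?_⟩
  -- The derivative of the helicity along the step, `2 (∑ lᵢ eᵢ, p)`, written as a polynomial.
  let q : Polynomial ℝ := ∑ i, ∑ k : Fin (s + 1),
    Polynomial.C (2 * (inner ℝ (e i) (b k) : ℝ)) * (l i * Polynomial.X ^ (k : ℕ))
  have hq : ∀ x, q.eval x = 2 * inner ℝ (∑ i, (l i).eval x • e i) (p x) := by
    intro x
    simp only [q, hp x, Polynomial.eval_finsetSum, Polynomial.eval_mul, Polynomial.eval_C,
      Polynomial.eval_pow, Polynomial.eval_X, sum_inner, inner_sum, real_inner_smul_left,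
      real_inner_smul_right, Finset.mul_sum]
    rw [Finset.sum_comm]
    refine Finset.sum_congr rfl fun i _ => ?_
    refine Finset.sum_congr rfl fun k _ => ?_
    ring
  have hqdeg : q.degree < ((2 * s : ℕ) : WithBot ℕ) := by
    refine (Polynomial.degree_lt_iff_coeff_zero _ _).2 fun m hm => ?_
    simp only [q, Polynomial.finsetSum_coeff]
    refine Finset.sum_eq_zero fun i _ => Finset.sum_eq_zero fun k _ => ?_
    rw [Polynomial.coeff_C_mul]
    -- The degree bound `(s - 1) + s < 2 s` needs a positive `s`, which the existence of `i`
    -- supplies.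
    have hs : 0 < s := i.pos
    have hd : (l i * Polynomial.X ^ (k : ℕ)).natDegree < m := by
      refine lt_of_le_of_lt Polynomial.natDegree_mul_le ?_
      rw [Polynomial.natDegree_X_pow,
        Lagrange.natDegree_basis hc.1.injOn (Finset.mem_univ i), Finset.card_univ,
        Fintype.card_fin]
      omega
    rw [Polynomial.coeff_eq_zero_of_natDegree_lt hd, mul_zero]
  have hq0 : ∀ i, q.eval (c i) = 0 := by
    intro i
    have : ∑ k, (l k).eval (c i) • e k = e i := by
      rw [Finset.sum_eq_single i]
      · rw [Lagrange.eval_basis_self hc.1.injOn (Finset.mem_univ i), one_smul]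
      · intro k _ hk
        rw [Lagrange.eval_basis_of_ne hk (Finset.mem_univ i), zero_smul]
      · simp
    rw [hq, this, horth i, mul_zero]
  have := hc.eq_of_hasDerivAt hqdeg hq0
    (h := fun x => inner ℝ (A + F x) (p x + BH)) fun x => by
      have h0 := ((hF x).const_add A).inner ℝ ((hpe x).add_const BH)
      refine h0.congr_deriv ?_
      have h1 := P.curl_symm _ (hAF x) _ (hmem fun i => (l i).eval x)
      have h2 : cA + cF x = p x - BH := by rw [hdec x]; abel
      simp only [h2] at h1
      rw [hq, h1, inner_add_right, inner_sub_left, real_inner_comm _ (p x), real_inner_comm _ BH]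
      ring
  have hF0 : F 0 = 0 := by simp [F, hK0]
  simp only [hF0, add_zero] at this
  exact this.symm

end HodgePair

/-! ### Vector calculus of test fields. -/

namespace Domain

variable {D : Domain}

section IsTest

variable {F G K : Type} [NormedAddCommGroup F] [NormedSpace ℝ F] [NormedAddCommGroup G]
  [NormedSpace ℝ G] [NormedAddCommGroup K] [NormedSpace ℝ K]

/-- Periodic smooth functions supported in the support of a test function are test functions. -/
theorem IsTest.of_tsupport_subset {φ : E3 → F} (hφ : D.IsTest φ) {ψ : E3 → G}
    (hs : ContDiff ℝ ∞ ψ) (hp : ∀ i x, ψ (x + EuclideanSpace.single i (D.period i)) = ψ x)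
    (hsub : tsupport ψ ⊆ tsupport φ) : D.IsTest ψ where
  smooth := hs
  periodic := hp
  support_subset := hsub.trans hφ.support_subset
  compact := hφ.compact.of_isClosed_subset (isClosed_closure.inter (isClosed_tsupport _))
    (inter_subset_inter_right _ hsub)

theorem IsTest.add {φ ψ : E3 → F} (hφ : D.IsTest φ) (hψ : D.IsTest ψ) :
    D.IsTest (fun x => φ x + ψ x) where
  smooth := hφ.smooth.add hψ.smooth
  periodic i x := by rw [hφ.periodic, hψ.periodic]
  support_subset := (tsupport_add φ ψ).trans
    (union_subset hφ.support_subset hψ.support_subset)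
  compact := by
    refine (hφ.compact.union hψ.compact).of_isClosed_subset
      (isClosed_closure.inter (isClosed_tsupport _)) ?_
    rw [← inter_union_distrib_left]
    exact inter_subset_inter_right _ (tsupport_add φ ψ)

theorem IsTest.zero : D.IsTest (fun _ => (0 : F)) where
  smooth := contDiff_const
  periodic _ _ := rfl
  support_subset := by simp [tsupport, Function.support_fun_zero]
  compact := by simp [tsupport, Function.support_fun_zero]

/-- Bilinear pairings of test functions are test functions. -/
theorem IsTest.bilin {φ : E3 → F} (hφ : D.IsTest φ) {ψ : E3 → G} (hψ : D.IsTest ψ)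
    (L : F →L[ℝ] G →L[ℝ] K) : D.IsTest (fun x => L (φ x) (ψ x)) := by
  refine hφ.of_tsupport_subset ?_ ?_ ?_
  · exact (L.contDiff.comp hφ.smooth).clm_apply hψ.smooth
  · intro i x
    rw [hφ.periodic, hψ.periodic]
  · refine closure_mono fun x hx h => hx ?_
    simp [h]

theorem IsTest.fderiv {φ : E3 → F} (hφ : D.IsTest φ) : D.IsTest (fderiv ℝ φ) := by
  refine hφ.of_tsupport_subset (hφ.smooth.fderiv_right le_rfl) ?_ (tsupport_fderiv_subset ℝ)
  intro i x
  rw [← fderiv_comp_add_right]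
  congr 1
  exact funext fun y => hφ.periodic i y

theorem IsTest.clm {φ : E3 → F} (hφ : D.IsTest φ) (L : F →L[ℝ] G) :
    D.IsTest (fun x => L (φ x)) := by
  refine hφ.of_tsupport_subset (L.contDiff.comp hφ.smooth) ?_ ?_
  · intro i x
    rw [hφ.periodic]
  · refine closure_mono fun x hx h => hx ?_
    simp [h]

end IsTest

/-- The cross product as a continuous bilinear map. -/
def crossL : E3 →L[ℝ] E3 →L[ℝ] E3 :=
  LinearMap.toContinuousLinearMap
    ((LinearMap.toContinuousLinearMap : (E3 →ₗ[ℝ] E3) ≃ₗ[ℝ] (E3 →L[ℝ] E3)).toLinearMap ∘ₗ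
      LinearMap.mk₂ ℝ cross
        (fun a b c => by ext i; simp [cross])
        (fun r a b => by ext i; simp [cross])
        (fun a b c => by ext i; simp [cross])
        (fun r a b => by ext i; simp [cross]))

@[simp] theorem crossL_apply (a b : E3) : crossL a b = cross a b := rfl

/-- The curl as a linear function of the Jacobian. -/
def curlL : (E3 →L[ℝ] E3) →L[ℝ] E3 :=
  LinearMap.toContinuousLinearMap
    { toFun := fun J => !₂[(J (EuclideanSpace.single 1 1)) 2 - (J (EuclideanSpace.single 2 1)) 1,
        (J (EuclideanSpace.single 2 1)) 0 - (J (EuclideanSpace.single 0 1)) 2,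
        (J (EuclideanSpace.single 0 1)) 1 - (J (EuclideanSpace.single 1 1)) 0]
      map_add' := fun J K => by
        ext i; fin_cases i <;> simp <;> ring
      map_smul' := fun r J => by
        ext i; fin_cases i <;> simp <;> ring }

theorem classicalCurl_eq (φ : E3 → E3) : classicalCurl φ = fun x => curlL (fderiv ℝ φ x) := rfl

/-- The divergence as a linear function of the Jacobian. -/
def divL : (E3 →L[ℝ] E3) →L[ℝ] ℝ :=
  LinearMap.toContinuousLinearMap
    { toFun := fun J => ∑ i, (J (EuclideanSpace.single i 1)) i
      map_add' := fun J K => by simp [Finset.sum_add_distrib]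
      map_smul' := fun r J => by simp [Finset.mul_sum] }

theorem classicalDiv_eq (φ : E3 → E3) : classicalDiv φ = fun x => divL (fderiv ℝ φ x) := rfl

theorem IsTest.differentiable {F : Type} [NormedAddCommGroup F] [NormedSpace ℝ F] {φ : E3 → F}
    (hφ : D.IsTest φ) : Differentiable ℝ φ := hφ.smooth.differentiable (by simp)

theorem IsTest.classicalCurl {φ : E3 → E3} (hφ : D.IsTest φ) : D.IsTest (classicalCurl φ) :=
  hφ.fderiv.clm curlL

theorem IsTest.classicalDiv {φ : E3 → E3} (hφ : D.IsTest φ) : D.IsTest (classicalDiv φ) :=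
  hφ.fderiv.clm divL

/-- The second partial derivatives cancel in pairs by symmetry of the Hessian. -/
theorem classicalDiv_classicalCurl {φ : E3 → E3} (hφ : ContDiff ℝ ∞ φ) (x : E3) :
    classicalDiv (classicalCurl φ) x = 0 := by
  have hd : HasFDerivAt (fderiv ℝ φ) (fderiv ℝ (fderiv ℝ φ) x) x :=
    ((hφ.fderiv_right (m := ∞) le_rfl).differentiable (by simp) x).hasFDerivAt
  have h1 : fderiv ℝ (classicalCurl φ) x = curlL.comp (fderiv ℝ (fderiv ℝ φ) x) :=
    (curlL.hasFDerivAt.comp x hd).fderiv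
  have hsymm : ∀ v w, fderiv ℝ (fderiv ℝ φ) x v w = fderiv ℝ (fderiv ℝ φ) x w v :=
    (contDiff_infty.1 hφ 2).contDiffAt.isSymmSndFDerivAt (by simp)
  rw [classicalDiv_eq]
  simp only [h1]
  simp only [divL, curlL, LinearMap.coe_toContinuousLinearMap', LinearMap.coe_mk, AddHom.coe_mk,
    ContinuousLinearMap.comp_apply, Fin.sum_univ_three]
  simp only [Matrix.cons_val_zero, Matrix.cons_val_one, Matrix.cons_val]
  rw [hsymm (EuclideanSpace.single 1 1) (EuclideanSpace.single 0 1),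
    hsymm (EuclideanSpace.single 2 1) (EuclideanSpace.single 0 1),
    hsymm (EuclideanSpace.single 2 1) (EuclideanSpace.single 1 1)]
  ring

theorem classicalDiv_cross {φ ψ : E3 → E3} (hφ : Differentiable ℝ φ) (hψ : Differentiable ℝ ψ)
    (x : E3) : classicalDiv (fun y => crossL (φ y) (ψ y)) x =
      inner ℝ (classicalCurl φ x) (ψ x) - inner ℝ (φ x) (classicalCurl ψ x) := by
  have h := (crossL.hasFDerivAt_of_bilinear (hφ x).hasFDerivAt (hψ x).hasFDerivAt).fderiv
  rw [classicalDiv_eq]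
  simp only [h]
  simp only [divL, classicalCurl, pd, LinearMap.coe_toContinuousLinearMap', LinearMap.coe_mk,
    AddHom.coe_mk, Fin.sum_univ_three, PiLp.inner_apply]
  simp [cross, cross_apply]
  ring

theorem classicalDiv_smul {f : E3 → ℝ} {φ : E3 → E3} (hf : Differentiable ℝ f)
    (hφ : Differentiable ℝ φ) (x : E3) :
    classicalDiv (fun y => f y • φ y) x =
      inner ℝ (gradient f x) (φ x) + inner ℝ (f x) (classicalDiv φ x) := by
  have h := ((hf x).hasFDerivAt.fun_smul (hφ x).hasFDerivAt).fderiv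
  have hg : inner ℝ (gradient f x) (φ x) = fderiv ℝ f x (φ x) := by
    rw [← toDual_gradient, InnerProductSpace.toDual_apply_apply]
  have hb : φ x = ∑ i, φ x i • EuclideanSpace.single i (1 : ℝ) := by
    ext j
    fin_cases j <;> simp [Fin.sum_univ_three]
  rw [hg, classicalDiv_eq, classicalDiv_eq]
  simp only [h]
  conv_rhs => rw [hb]
  simp [divL, Fin.sum_univ_three]
  ring

/-! ### The divergence theorem modulo periods. -/

theorem mem_closure_cell {x : E3} (hx : ∀ i, D.period i ≠ 0 → x i ∈ Icc 0 (D.period i)) :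
    x ∈ closure D.cell := by
  -- Shrinking `x` towards the origin moves it off the excluded upper faces of the cell.
  have hlim : Filter.Tendsto (fun n : ℕ => (1 - 1 / ((n : ℝ) + 1)) • x) Filter.atTop
      (nhds x) := by
    have := (tendsto_one_div_add_atTop_nhds_zero_nat (𝕜 := ℝ)).const_sub 1
    simpa using this.smul_const x
  refine mem_closure_of_tendsto hlim (Filter.Eventually.of_forall fun n i hi => ?_)
  have h1 : (0 : ℝ) < 1 / ((n : ℝ) + 1) := by positivity
  have h2 : 1 / ((n : ℝ) + 1) ≤ 1 := by
    rw [div_le_one (by positivity)]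
    linarith [(Nat.cast_nonneg n : (0 : ℝ) ≤ n)]
  have hP : 0 < D.period i := lt_of_le_of_ne (D.period_nonneg i) (Ne.symm hi)
  obtain ⟨h3, h4⟩ := hx i hi
  rw [PiLp.smul_apply, smul_eq_mul]
  refine ⟨mul_nonneg (by linarith) h3, ?_⟩
  calc (1 - 1 / ((n : ℝ) + 1)) * x i ≤ (1 - 1 / ((n : ℝ) + 1)) * D.period i := by
        gcongr
    _ < D.period i := by nlinarith

theorem measurableSet_cell : MeasurableSet D.cell := by
  have : D.cell = ⋂ i, {x : E3 | D.period i ≠ 0 → x i ∈ Ico 0 (D.period i)} := by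
    ext x; simp [cell]
  rw [this]
  refine MeasurableSet.iInter fun i => ?_
  by_cases hi : D.period i = 0
  · simp [hi]
  · simp only [ne_eq, hi, not_false_eq_true, forall_const]
    exact measurableSet_Ico.preimage (by fun_prop : Measurable fun x : E3 => x i)

/-- Lower corner of a box that contains one cell of a field supported in the ball of radius `R`. -/
def boxLower (D : Domain) (R : ℝ) (i : Fin 3) : ℝ := if D.period i = 0 then -R else 0

/-- Upper corner of that box. -/
def boxUpper (D : Domain) (R : ℝ) (i : Fin 3) : ℝ := if D.period i = 0 then R else D.period i

/-- The box has side one period in periodic directions, and elsewhere the bound `R` traps the part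
of `T` in the cell. Half-open and closed boxes differ by a null set. -/
theorem integral_vol_eq_box {g : E3 → ℝ} {T : Set E3} (hT : T ⊆ D.carrier)
    (hg : ∀ x ∉ T, g x = 0) {R : ℝ} (hR : ∀ x ∈ closure D.cell ∩ T, ‖x‖ < R) :
    ∫ x, g x ∂D.vol =
      ∫ y in Icc (D.boxLower R) (D.boxUpper R), g (WithLp.toLp 2 y) := by
  let S : Set E3 := WithLp.ofLp ⁻¹' (pi univ fun i => Ico (D.boxLower R i) (D.boxUpper R i))
  have hmp := PiLp.volume_preserving_ofLp (Fin 3)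
  have hSm : MeasurableSet S :=
    hmp.measurable (MeasurableSet.univ_pi fun _ => measurableSet_Ico)
  have hS : S ⊆ D.cell := by
    intro x hx i hi
    have := hx i (mem_univ i)
    simpa [boxLower, boxUpper, hi] using this
  have h1 : ∫ y in Icc (D.boxLower R) (D.boxUpper R), g (WithLp.toLp 2 y) = ∫ x in S, g x := by
    rw [volume_pi, ← setIntegral_congr_set (Measure.univ_pi_Ico_ae_eq_Icc (μ := fun _ => volume)),
      ← volume_pi, ← hmp.setIntegral_preimage_emb
        (MeasurableEquiv.toLp 2 (Fin 3 → ℝ)).symm.measurableEmbedding]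
  have h2 : ∫ x in S, g x = ∫ x in S ∩ D.carrier, g x :=
    setIntegral_eq_of_subset_of_forall_sdiff_eq_zero hSm inter_subset_left
      fun x hx => hg x fun hxT => hx.2 ⟨hx.1, hT hxT⟩
  have h3 : ∫ x in D.carrier ∩ D.cell, g x = ∫ x in S ∩ D.carrier, g x := by
    refine setIntegral_eq_of_subset_of_forall_sdiff_eq_zero
      (D.isOpen.measurableSet.inter measurableSet_cell) (fun x hx => ⟨hx.2, hS hx.1⟩) ?_
    intro x hx
    refine hg x fun hxT => hx.2 ⟨fun i _ => ?_, hx.1.1⟩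
    have hn := hR x ⟨subset_closure hx.1.2, hxT⟩
    by_cases hi : D.period i = 0
    · have h4 : |x i| < R := lt_of_le_of_lt (PiLp.norm_apply_le x i) hn
      simp only [boxLower, boxUpper, hi, if_true]
      exact ⟨(abs_lt.1 h4).1.le, (abs_lt.1 h4).2⟩
    · simpa [boxLower, boxUpper, hi] using hx.1.2 i hi
  rw [h1, h2, ← h3]
  rfl

/-- The divergence theorem for test fields. -/
theorem integral_classicalDiv {φ : E3 → E3} (hφ : D.IsTest φ) :
    ∫ x, classicalDiv φ x ∂D.vol = 0 := by
  obtain ⟨R, hR0, hR⟩ : ∃ R : ℝ, 0 < R ∧ ∀ x ∈ closure D.cell ∩ tsupport φ, ‖x‖ < R := by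
    obtain ⟨R, hR⟩ := hφ.compact.isBounded.exists_norm_le
    refine ⟨max R 0 + 1, by positivity, fun x hx => ?_⟩
    linarith [hR x hx, le_max_left R 0]
  have hdiv0 : ∀ x ∉ tsupport φ, classicalDiv φ x = 0 := by
    intro x hx
    rw [classicalDiv_eq]
    simp only [fderiv_of_notMem_tsupport (𝕜 := ℝ) hx, map_zero]
  rw [integral_vol_eq_box hφ.support_subset hdiv0 hR]
  set a := D.boxLower R with ha
  set b := D.boxUpper R with hb
  let e : E3 ≃L[ℝ] (Fin 3 → ℝ) := EuclideanSpace.equiv (Fin 3) ℝ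
  have hab : a ≤ b := by
    intro i
    simp only [ha, hb, boxLower, boxUpper]
    split_ifs
    · linarith
    · exact D.period_nonneg i
  have hcont : Continuous fun y : Fin 3 → ℝ => classicalDiv φ (WithLp.toLp 2 y) :=
    hφ.classicalDiv.smooth.continuous.comp e.symm.continuous
  have key := integral_divergence_of_hasFDerivAt_off_countable a b hab
    (fun y => e (φ (e.symm y)))
    (fun y => (e : E3 →L[ℝ] (Fin 3 → ℝ)) ∘L (fderiv ℝ φ (e.symm y)) ∘L
      (e.symm : (Fin 3 → ℝ) →L[ℝ] E3)) ∅ countable_empty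
    ((e.continuous.comp (hφ.smooth.continuous.comp e.symm.continuous)).continuousOn)
    (fun y _ => (e.hasFDerivAt (x := φ (e.symm y))).comp y
      (((hφ.differentiable (e.symm y)).hasFDerivAt).comp y e.symm.hasFDerivAt))
    (hcont.continuousOn.integrableOn_compact isCompact_Icc)
  refine Eq.trans (Eq.trans rfl key) ?_
  -- Opposite faces cancel: the field vanishes on both in a non-periodic direction, and takes equal
  -- values on both in a periodic one.
  refine Finset.sum_eq_zero fun i _ => sub_eq_zero.2 ?_
  refine setIntegral_congr_fun measurableSet_Icc fun y hy => ?_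
  have hbox : ∀ r ∈ Icc (a i) (b i), e.symm (i.insertNth r y) ∈ closure D.cell := by
    intro r hr
    refine mem_closure_cell fun k hk => ?_
    have hmem : (i.insertNth r y : Fin 3 → ℝ) k ∈ Icc (a k) (b k) := by
      refine Fin.succAboveCases i ?_ (fun m => ?_) k
      · simpa using hr
      · simpa using ⟨hy.1 m, hy.2 m⟩
    simpa [e, ha, hb, boxLower, boxUpper, hk] using hmem
  by_cases hi : D.period i = 0
  · have hzero : ∀ r ∈ Icc (a i) (b i), R ≤ |r| → φ (e.symm (i.insertNth r y)) = 0 := by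
      intro r hr hrR
      refine image_eq_zero_of_notMem_tsupport fun hT => ?_
      have h1 := hR _ ⟨hbox r hr, hT⟩
      have h2 := PiLp.norm_apply_le (e.symm (i.insertNth r y)) i
      have h3 : (e.symm (i.insertNth r y)) i = r := by simp [e]
      rw [h3, Real.norm_eq_abs] at h2
      linarith
    have h1 := hzero (b i) (right_mem_Icc.2 (hab i)) (by
      simp [hb, boxUpper, hi, abs_of_pos hR0])
    have h2 := hzero (a i) (left_mem_Icc.2 (hab i)) (by
      simp [ha, boxLower, hi, abs_of_pos hR0])
    simp only [h1, h2]
  · have h1 : e.symm (i.insertNth (b i) y) =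
        e.symm (i.insertNth (a i) y) + EuclideanSpace.single i (D.period i) := by
      ext k
      refine Fin.succAboveCases i ?_ (fun m => ?_) k
      · simp [e, ha, hb, boxLower, boxUpper, hi]
      · simp [e]
    simp only [h1, hφ.periodic]

/-! ### Green's identities and their extension to the closures. -/

theorem testCurl_symm {p q : D.L2V × D.L2V} (hp : p ∈ D.testCurl) (hq : q ∈ D.testCurl) :
    inner ℝ p.1 q.2 = inner ℝ p.2 q.1 := by
  obtain ⟨φ, hφ, h1, h2⟩ := hp
  obtain ⟨ψ, hψ, h3, h4⟩ := hq
  -- The difference of the two sides is the integral of `div (φ × ψ)`.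
  rw [eq_comm, ← sub_eq_zero, L2.inner_def, L2.inner_def,
    ← integral_sub (L2.integrable_inner _ _) (L2.integrable_inner _ _),
    ← integral_classicalDiv (hφ.bilin hψ crossL)]
  refine integral_congr_ae ?_
  filter_upwards [h1, h2, h3, h4] with x h1 h2 h3 h4
  rw [h1, h2, h3, h4, classicalDiv_cross hφ.differentiable hψ.differentiable]

theorem inner_testGrad_testDiv {p : D.L2S × D.L2V} {q : D.L2V × D.L2S} (hp : p ∈ D.testGrad)
    (hq : q ∈ D.testDiv) : inner ℝ p.2 q.1 + inner ℝ p.1 q.2 = 0 := by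
  obtain ⟨f, hf, h1, h2⟩ := hp
  obtain ⟨φ, hφ, h3, h4⟩ := hq
  rw [L2.inner_def, L2.inner_def,
    ← integral_add (L2.integrable_inner _ _) (L2.integrable_inner _ _),
    ← integral_classicalDiv (hf.bilin hφ (ContinuousLinearMap.lsmul ℝ ℝ))]
  refine integral_congr_ae ?_
  filter_upwards [h1, h2, h3, h4] with x h1 h2 h3 h4
  rw [h1, h2, h3, h4]
  exact (classicalDiv_smul hf.differentiable hφ.differentiable x).symm

/-- The curl on test fields as a linear relation. -/
def testCurlGraph (D : Domain) : Submodule ℝ (D.L2V × D.L2V) where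
  carrier := D.testCurl
  zero_mem' := ⟨fun _ => 0, IsTest.zero, Lp.coeFn_zero _ _ _, by
    filter_upwards [Lp.coeFn_zero E3 2 D.vol] with x hx
    rw [Prod.snd_zero, hx, classicalCurl_eq]
    simp⟩
  add_mem' := by
    rintro p q ⟨φ, hφ, h1, h2⟩ ⟨ψ, hψ, h3, h4⟩
    refine ⟨_, hφ.add hψ, ?_, ?_⟩
    · filter_upwards [h1, h3, Lp.coeFn_add p.1 q.1] with x h1 h3 h
      rw [Prod.fst_add, h, Pi.add_apply, h1, h3]
    · filter_upwards [h2, h4, Lp.coeFn_add p.2 q.2] with x h2 h4 h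
      rw [Prod.snd_add, h, Pi.add_apply, h2, h4]
      simp only [classicalCurl_eq]
      rw [fderiv_fun_add (hφ.differentiable x) (hψ.differentiable x), map_add]
  smul_mem' := by
    rintro r p ⟨φ, hφ, h1, h2⟩
    refine ⟨_, hφ.clm (r • ContinuousLinearMap.id ℝ E3), ?_, ?_⟩
    · filter_upwards [h1, Lp.coeFn_smul r p.1] with x h1 h
      rw [Prod.smul_fst, h, Pi.smul_apply, h1]
      rfl
    · filter_upwards [h2, Lp.coeFn_smul r p.2] with x h2 h
      rw [Prod.smul_snd, h, Pi.smul_apply, h2]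
      simp only [classicalCurl_eq, smul_apply, ContinuousLinearMap.id_apply]
      rw [fderiv_fun_const_smul (hφ.differentiable x), map_smul]

/-- The divergence on test fields as a linear relation. -/
def testDivGraph (D : Domain) : Submodule ℝ (D.L2V × D.L2S) where
  carrier := D.testDiv
  zero_mem' := ⟨fun _ => 0, IsTest.zero, Lp.coeFn_zero _ _ _, by
    filter_upwards [Lp.coeFn_zero ℝ 2 D.vol] with x hx
    rw [Prod.snd_zero, hx, classicalDiv_eq]
    simp⟩
  add_mem' := by
    rintro p q ⟨φ, hφ, h1, h2⟩ ⟨ψ, hψ, h3, h4⟩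
    refine ⟨_, hφ.add hψ, ?_, ?_⟩
    · filter_upwards [h1, h3, Lp.coeFn_add p.1 q.1] with x h1 h3 h
      rw [Prod.fst_add, h, Pi.add_apply, h1, h3]
    · filter_upwards [h2, h4, Lp.coeFn_add p.2 q.2] with x h2 h4 h
      rw [Prod.snd_add, h, Pi.add_apply, h2, h4]
      simp only [classicalDiv_eq]
      rw [fderiv_fun_add (hφ.differentiable x) (hψ.differentiable x), map_add]
  smul_mem' := by
    rintro r p ⟨φ, hφ, h1, h2⟩
    refine ⟨_, hφ.clm (r • ContinuousLinearMap.id ℝ E3), ?_, ?_⟩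
    · filter_upwards [h1, Lp.coeFn_smul r p.1] with x h1 h
      rw [Prod.smul_fst, h, Pi.smul_apply, h1]
      rfl
    · filter_upwards [h2, Lp.coeFn_smul r p.2] with x h2 h
      rw [Prod.smul_snd, h, Pi.smul_apply, h2]
      simp only [classicalDiv_eq, smul_apply, ContinuousLinearMap.id_apply]
      rw [fderiv_fun_const_smul (hφ.differentiable x), map_smul]

/-- The graph of `curl` on `H₀(curl)`. -/
def curlGraph (D : Domain) : Submodule ℝ (D.L2V × D.L2V) := D.testCurlGraph.topologicalClosure

/-- The graph of `div` on `H₀(div)`. -/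
def divGraph (D : Domain) : Submodule ℝ (D.L2V × D.L2S) := D.testDivGraph.topologicalClosure

theorem isClosed_curlGraph : IsClosed (D.curlGraph : Set (D.L2V × D.L2V)) :=
  D.testCurlGraph.isClosed_topologicalClosure

/-- Both sides are continuous in the pair, and the closure of a product is the product of the
closures. -/
theorem curlGraph_symm {p q : D.L2V × D.L2V} (hp : p ∈ D.curlGraph) (hq : q ∈ D.curlGraph) :
    inner ℝ p.1 q.2 = inner ℝ p.2 q.1 := by
  have hcl : IsClosed {z : (D.L2V × D.L2V) × (D.L2V × D.L2V) |
      (inner ℝ z.1.1 z.2.2 : ℝ) = inner ℝ z.1.2 z.2.1} :=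
    isClosed_eq (by fun_prop) (by fun_prop)
  have hsub : D.testCurl ×ˢ D.testCurl ⊆ {z : (D.L2V × D.L2V) × (D.L2V × D.L2V) |
      (inner ℝ z.1.1 z.2.2 : ℝ) = inner ℝ z.1.2 z.2.1} := fun z hz => testCurl_symm hz.1 hz.2
  refine closure_minimal hsub hcl (?_ : (p, q) ∈ _)
  rw [closure_prod_eq]
  exact ⟨hp, hq⟩

theorem IsGrad₀.inner_add_inner {f : D.L2S} {g : D.L2V} {v : D.L2V} {q : D.L2S}
    (hf : D.IsGrad₀ f g) (hv : D.IsDiv₀ v q) : inner ℝ g v + inner ℝ f q = 0 := by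
  have hcl : IsClosed {z : (D.L2S × D.L2V) × (D.L2V × D.L2S) |
      (inner ℝ z.1.2 z.2.1 : ℝ) + inner ℝ z.1.1 z.2.2 = 0} :=
    isClosed_eq (by fun_prop) (by fun_prop)
  have hsub : D.testGrad ×ˢ D.testDiv ⊆ {z : (D.L2S × D.L2V) × (D.L2V × D.L2S) |
      (inner ℝ z.1.2 z.2.1 : ℝ) + inner ℝ z.1.1 z.2.2 = 0} :=
    fun z hz => inner_testGrad_testDiv hz.1 hz.2
  refine closure_minimal hsub hcl (?_ : ((f, g), (v, q)) ∈ _)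
  rw [closure_prod_eq]
  exact ⟨hf, hv⟩

/-- Curls of fields in `H₀(curl)` are divergence-free fields in `H₀(div)`. -/
theorem IsCurl₀.isDiv₀ {v w : D.L2V} (h : D.IsCurl₀ v w) : D.IsDiv₀ w 0 := by
  have hcl : IsClosed {p : D.L2V × D.L2V | (p.2, (0 : D.L2S)) ∈ closure D.testDiv} :=
    isClosed_closure.preimage (by fun_prop)
  refine closure_minimal ?_ hcl h
  rintro p ⟨φ, hφ, -, h2⟩
  refine subset_closure ⟨_, hφ.classicalCurl, h2, ?_⟩
  filter_upwards [Lp.coeFn_zero ℝ 2 D.vol] with x hx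
  rw [hx, classicalDiv_classicalCurl hφ.smooth]
  rfl

theorem IsWeakCurl.inner_curlGraph {v w : D.L2V} (h : D.IsWeakCurl v w) {p : D.L2V × D.L2V}
    (hp : p ∈ D.curlGraph) : inner ℝ v p.2 = inner ℝ w p.1 := by
  have hcl : IsClosed {p : D.L2V × D.L2V | (inner ℝ v p.2 : ℝ) = inner ℝ w p.1} :=
    isClosed_eq (by fun_prop) (by fun_prop)
  exact closure_minimal (fun p hp => h p hp) hcl hp

/-- On curl-exact domains, curl-free fields in `H₀(curl)` are orthogonal to divergence-free fields
in `H₀(div)`. -/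
theorem ExactAtCurl.inner_eq_zero (hexact : D.ExactAtCurl) {A v : D.L2V} (hA : D.IsCurl₀ A 0)
    (hv : D.IsDiv₀ v 0) : inner ℝ A v = 0 := by
  obtain ⟨f, hf⟩ := hexact A hA
  simpa using hf.inner_add_inner hv

end Domain

/-! ### The magneto-frictional evolution. -/

theorem inner_cross_self_right (a b : E3) : inner ℝ (cross a b) b = 0 := by
  simp only [PiLp.inner_apply, Fin.sum_univ_three]
  simp [cross, cross_apply]
  ring

namespace Domain

variable {D : Domain}

/-- The Hodge decomposition in `L²` on a curl-exact domain. -/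
def hodgePair (D : Domain) (hexact : D.ExactAtCurl) : HodgePair D.L2V where
  curl := D.curlGraph
  isClosed_curl := isClosed_curlGraph
  harmonic := {v | D.IsHarmonic v}
  curl_symm _ hp _ hq := curlGraph_symm hp hq
  harmonic_range v hv p hp := by rw [hv.2.inner_curlGraph hp, inner_zero_left]
  harmonic_ker v hv p hp h0 := hexact.inner_eq_zero (h0 ▸ hp : D.IsCurl₀ p.1 0) hv.1

theorem IsSolution.inner_E_B {τ : ℝ} {I : Set ℝ} {B E j : ℝ → D.L2V} {u : ℝ → E3 → E3}
    (hsol : D.IsSolution τ I B E j u) {t : ℝ} (ht : t ∈ I) : inner ℝ (E t) (B t) = 0 := by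
  rw [L2.inner_def]
  refine integral_eq_zero_of_ae ?_
  filter_upwards [hsol.ohm t ht] with x hx
  rw [eq_neg_of_add_eq_zero_left hx, inner_neg_left, inner_cross_self_right]
  simp

theorem IsSolution.hasHelicity (hexact : D.ExactAtCurl) {τ : ℝ} {I : Set ℝ}
    {B E j : ℝ → D.L2V} {u : ℝ → E3 → E3} (hI : I.OrdConnected)
    (hsol : D.IsSolution τ I B E j u) {s t : ℝ} (hs : s ∈ I) (ht : t ∈ I) {h : ℝ}
    (H : D.HasHelicity (B s) h) : D.HasHelicity (B t) h := by
  obtain ⟨dB, hdB, hadv⟩ := hsol.advection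
  have hsub : uIcc s t ⊆ I := hI.uIcc_subset hs ht
  -- Taking `curl E = -∂ₜB` makes the curl continuous in time. The concrete and abstract
  -- `HasHelicity` agree by unfolding.
  refine (D.hodgePair hexact).hasHelicity_of_curve (E := E) (cE := fun r => -dB r)
    (hsol.continuous_E.mono hsub) (hdB.mono hsub).neg ?_ ?_
    (fun r hr => hsol.inner_E_B (hsub hr)) H
  · intro r hr
    obtain ⟨-, cE, hcE, h0⟩ := hadv r (hsub hr)
    rw [← eq_neg_of_add_eq_zero_right h0]
    exact hcE
  · intro r hr
    rw [neg_neg]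
    exact (hadv r (hsub hr)).1.mono hsub

/-! ### The semi-discrete and Gauss collocation schemes. -/

namespace Subcomplex

variable (S : D.Subcomplex)

instance : FiniteDimensional ℝ S.V₁ := S.finite₁

instance : FiniteDimensional ℝ S.V₂ := S.finite₂

/-- The graph of `curl : V₁ → V₂`. -/
def curlGraph : Submodule ℝ (D.L2V × D.L2V) where
  carrier := {p | S.IsCurl p.1 p.2}
  zero_mem' := ⟨S.V₁.zero_mem, S.V₂.zero_mem, D.curlGraph.zero_mem⟩
  add_mem' hp hq := ⟨S.V₁.add_mem hp.1 hq.1, S.V₂.add_mem hp.2.1 hq.2.1,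
    D.curlGraph.add_mem hp.2.2 hq.2.2⟩
  smul_mem' r _ hp := ⟨S.V₁.smul_mem r hp.1, S.V₂.smul_mem r hp.2.1,
    D.curlGraph.smul_mem r hp.2.2⟩

theorem isClosed_curlGraph : IsClosed (S.curlGraph : Set (D.L2V × D.L2V)) :=
  (S.V₁.closed_of_finiteDimensional.preimage continuous_fst).inter
    ((S.V₂.closed_of_finiteDimensional.preimage continuous_snd).inter
      Domain.isClosed_curlGraph)

/-- The discrete Hodge decomposition on a curl-exact domain. -/
def hodgePair (hexact : D.ExactAtCurl) : HodgePair D.L2V where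
  curl := S.curlGraph
  isClosed_curl := S.isClosed_curlGraph
  harmonic := {v | S.IsHarmonic v}
  curl_symm _ hp _ hq := curlGraph_symm hp.2.2 hq.2.2
  harmonic_range _ hv p hp := hv.2.2 p.1 p.2 hp
  harmonic_ker _ hv p hp h0 := hexact.inner_eq_zero (h0 ▸ hp.2.2 : D.IsCurl₀ p.1 0) hv.2.1

/-- Divergence-free fields in `V₂` have a discrete Hodge decomposition. -/
theorem exists_hasHelicity {B : D.L2V} (hB : B ∈ S.V₂) (hdiv : D.IsDiv₀ B 0) :
    ∃ h, S.HasHelicity B h := by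
  -- Projecting onto `curl V₁` gives the decomposition without exactness at `V₂`; the remainder
  -- stays divergence-free because curls are.
  let W : Submodule ℝ D.L2V := S.curlGraph.map (LinearMap.snd ℝ D.L2V D.L2V)
  have hWV : W ≤ S.V₂ := by
    rintro _ ⟨p, hp, rfl⟩
    exact hp.2.1
  have : FiniteDimensional ℝ W := Submodule.finiteDimensional_of_le hWV
  obtain ⟨⟨A, cA⟩, hA, hcA⟩ : W.starProjection B ∈ W := W.starProjection_apply_mem B
  change cA = _ at hcA
  refine ⟨_, A, B - cA, ⟨⟨S.V₂.sub_mem hB hA.2.1, ?_, ?_⟩, cA, hA, by abel⟩, rfl⟩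
  · have := D.divGraph.sub_mem hdiv hA.2.2.isDiv₀
    rwa [Prod.mk_sub_mk, sub_zero] at this
  · intro K cK hK
    rw [hcA]
    exact W.starProjection_inner_eq_zero B cK ⟨(K, cK), hK, rfl⟩

variable {S}

/-- Advection is tested only against `V₂`, so it fixes just the projection of `dB`; this form gives
a curl that depends continuously on `dB`. -/
theorem SchemeAt.isCurl {τ : ℝ} {B dB E j H : D.L2V} (h : S.SchemeAt τ B dB E j H) :
    S.IsCurl E (-S.V₂.starProjection dB) := by
  obtain ⟨cE, hcE, hadv⟩ := h.advection
  have : S.V₂.starProjection dB = -cE := by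
    refine Submodule.eq_starProjection_of_mem_of_inner_eq_zero (S.V₂.neg_mem hcE.2.1) ?_
    intro C hC
    rw [sub_neg_eq_add, inner_add_left, hadv C hC]
  rwa [this, neg_neg]

theorem SchemeAt.inner_E_B {τ : ℝ} {B dB E j H : D.L2V} (h : S.SchemeAt τ B dB E j H) :
    inner ℝ E B = 0 := by
  -- With test field `H` the triple product vanishes pointwise.
  have h1 := (h.ohm H h.mem_H).2
  simp only [inner_cross_self_right, integral_zero, mul_zero, add_zero] at h1
  rw [real_inner_comm, ← h.field E h.isCurl.1, real_inner_comm, h1]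

theorem IsSolution.hasHelicity (hexact : D.ExactAtCurl) {τ : ℝ} {I : Set ℝ}
    {B E j H : ℝ → D.L2V} (hI : I.OrdConnected) (hsol : S.IsSolution τ I B E j H) {s t : ℝ}
    (hs : s ∈ I) (ht : t ∈ I) {h : ℝ} (hB : S.HasHelicity (B s) h) :
    S.HasHelicity (B t) h := by
  obtain ⟨dB, hdB, hsch⟩ := hsol.scheme
  have hsub : uIcc s t ⊆ I := hI.uIcc_subset hs ht
  refine (S.hodgePair hexact).hasHelicity_of_curve (E := E)
    (cE := fun r => -S.V₂.starProjection (dB r)) (hsol.continuous_E.mono hsub)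
    (S.V₂.starProjection.continuous.comp_continuousOn (hdB.mono hsub)).neg
    (fun r hr => (hsch r (hsub hr)).2.isCurl) ?_
    (fun r hr => (hsch r (hsub hr)).2.inner_E_B) hB
  intro r hr
  rw [neg_neg]
  -- `B` stays in `V₂`, so projecting `B` changes nothing and its derivative may be replaced by the
  -- projected one.
  have hproj : ∀ x ∈ uIcc s t, B x = (S.V₂.starProjection ∘ B) x := fun x hx =>
    (Submodule.starProjection_eq_self_iff.2 (hsch x (hsub hx)).2.mem_B).symm
  exact (S.V₂.starProjection.hasFDerivAt.comp_hasDerivWithinAt r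
    ((hsch r (hsub hr)).1.mono hsub)).congr hproj (hproj r hr)

theorem IsCollocationStep.hasHelicity (hexact : D.ExactAtCurl) {τ δ : ℝ} {s : ℕ}
    {c : Fin s → ℝ} (hc : IsGaussNodes c) {B B' : D.L2V}
    (hstep : S.IsCollocationStep τ c δ B B') {h : ℝ} (hB : S.HasHelicity B h) :
    S.HasHelicity B' h := by
  obtain ⟨a, p, E, j, H, ha, hp, rfl, rfl, hsch⟩ := hstep
  have hdiff : Differentiable ℝ p := by
    rw [show p = fun r => ∑ k : Fin (s + 1), r ^ (k : ℕ) • a k from funext hp]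
    fun_prop
  have hproj : ∀ r, S.V₂.starProjection (p r) = p r := fun r =>
    Submodule.starProjection_eq_self_iff.2 (by
      rw [hp r]
      exact S.V₂.sum_mem fun k _ => S.V₂.smul_mem _ (ha k))
  have hderiv : ∀ r, HasDerivAt p (S.V₂.starProjection (deriv p r)) r := by
    intro r
    have := S.V₂.starProjection.hasFDerivAt.comp_hasDerivAt r (hdiff r).hasDerivAt
    rwa [show S.V₂.starProjection ∘ p = p from funext hproj] at this
  -- The step is rescaled to `[0, 1]`; the factor `-δ` combines the chain rule with the sign in `∂ₜB
  -- = -curl E`.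
  have key := (S.hodgePair hexact).hasHelicity_of_gauss hc (fun k => δ ^ (k : ℕ) • a k)
    (fun x => p (x * δ)) (fun x => ?_) (fun i => (-δ) • E i)
    (fun i => (-δ) • -S.V₂.starProjection (deriv p (c i * δ)))
    (fun i => ?_) (fun i => ?_) (fun i => ?_) (h := h)
  · simp only [zero_mul, one_mul] at key
    exact key hB
  · simp only [hp, mul_pow, smul_smul]
  · have hmem : (E i, -S.V₂.starProjection (deriv p (c i * δ))) ∈ S.curlGraph := (hsch i).isCurl
    exact S.curlGraph.smul_mem (-δ) hmem
  · rw [smul_neg, neg_smul, neg_neg]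
    exact HasDerivAt.scomp (c i) (hderiv (c i * δ))
      (by simpa using (hasDerivAt_id (c i)).mul_const δ)
  · rw [real_inner_smul_left, (hsch i).inner_E_B, mul_zero]

end Subcomplex

end Domain

end MagnetoFriction

end

theorem theorem3p5 (D : MagnetoFriction.Domain) (hexact : D.ExactAtCurl) (τ : ℝ) (hτ : 0 < τ) :
    -- the magneto-frictional evolution
    (∀ (I : Set ℝ) (B E j : ℝ → D.L2V)
        (u : ℝ → MagnetoFriction.E3 → MagnetoFriction.E3),
        I.OrdConnected → I ⊆ Set.Ici 0 → 0 ∈ I → D.IsSolution τ I B E j u →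
        ∀ s ∈ I, ∀ h : ℝ, D.HasHelicity (B s) h →
          ∀ t ∈ I, ∀ h' : ℝ, D.HasHelicity (B t) h' ↔ h' = h) ∧
    -- the semi-discrete scheme
    (∀ (S : D.Subcomplex) (I : Set ℝ) (B E j H : ℝ → D.L2V),
        I.OrdConnected → I ⊆ Set.Ici 0 → 0 ∈ I → S.IsSolution τ I B E j H →
        ∃ h : ℝ, ∀ t ∈ I, ∀ h' : ℝ, S.HasHelicity (B t) h' ↔ h' = h) ∧
    -- the scheme with Gauss collocation in time
    (∀ (S : D.Subcomplex) (s : ℕ) (c : Fin s → ℝ) (N : ℕ) (δ : ℕ → ℝ) (B : ℕ → D.L2V),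
        MagnetoFriction.IsGaussNodes c → (∀ n < N, 0 < δ n) → B 0 ∈ S.V₂ → D.IsDiv₀ (B 0) 0 →
        (∀ n < N, S.IsCollocationStep τ c (δ n) (B n) (B (n + 1))) →
        ∃ h : ℝ, ∀ n ≤ N, ∀ h' : ℝ, S.HasHelicity (B n) h' ↔ h' = h) := by
  refine ⟨?_, ?_, ?_⟩
  · intro I B E j u hI _ _ hsol s hs h H t ht h'
    have Ht := hsol.hasHelicity hexact hI hs ht H
    exact ⟨fun H' => (D.hodgePair hexact).hasHelicity_unique H' Ht, fun e => e ▸ Ht⟩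
  · intro S I B E j H hI _ h0 hsol
    obtain ⟨dB, -, hsch⟩ := hsol.scheme
    obtain ⟨h, hh⟩ := S.exists_hasHelicity (hsch 0 h0).2.mem_B hsol.gauss_zero
    refine ⟨h, fun t ht h' => ?_⟩
    have Ht := hsol.hasHelicity hexact hI h0 ht hh
    exact ⟨fun H' => (S.hodgePair hexact).hasHelicity_unique H' Ht, fun e => e ▸ Ht⟩
  · intro S s c N δ B hc _ hB0 hdiv hstep
    obtain ⟨h, hh⟩ := S.exists_hasHelicity hB0 hdiv
    refine ⟨h, fun n hn h' => ?_⟩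
    have Hn : S.HasHelicity (B n) h := by
      induction n with
      | zero => exact hh
      | succ n ih => exact (hstep n (by omega)).hasHelicity hexact hc (ih (by omega))
    exact ⟨fun H' => (S.hodgePair hexact).hasHelicity_unique H' Hn, fun e => e ▸ Hn⟩
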